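/- Let $H$ be a real separable Hilbert space, let $\mathcal P_2(H)$ be the set of Borel probability measures $\mu$ on $H$ with $m_2^2(\mu):=\int_H|x|^2\,d\mu(x)<\infty$, endowed with the 2-Wasserstein distance $$W_2(\mu,\nu)=\inf\Big\{\Big(\int_{H\times H}|x-y|^2\,d\gamma(x,y)\Big)^{1/2} : \gamma\text{ a Borel probability measure on }H\times H\text{ with marginals }\mu,\nu\Big\}$$ and with the corresponding Borel $\sigma$-algebra. Let $\lambda$ be a (finite, countably additive) signed measure on $\mathcal P_2(H)$ with Hahn–Jordan decomposition $\lambda=\lambda^+-\lambda^-$ and total variation $|\lambda|=\lambda^++\lambda^-$, such that $$\lambda(\mathcal P_2(H))=1\qquad\text{and}\qquad \int_{\mathcal P_2(H)}m_2^2(\nu)\,d|\lambda|(\nu)<\infty .$$ Suppose that $\lambda^+$ is concentrated on a single measure, i.e. there is $\nu_0\in\mathcal P_2(H)$ with $\lambda^+(\mathcal P_2(H)\setminus\{\nu_0\})=0$. Then for every $\mu\in\mathcal P_2(H)$ the function $\nu\mapsto W_2^2(\mu,\nu)$ is $|\lambda|$-integrable, so that $$\mathscr E(\mu):=\int_{\mathcal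 P_2(H)}W_2^2(\mu,\nu)\,d\lambda(\nu)=\int W_2^2(\mu,\nu)\,d\lambda^+(\nu)-\int W_2^2(\mu,\nu)\,d\lambda^-(\nu)$$ is a well-defined real number, and the functional $\mathscr E:\mathcal P_2(H)\to\mathbb R$ has a unique minimizer: there is exactly one $\bar\mu\in\mathcal P_2(H)$ with $\mathscr E(\bar\mu)\le\mathscr E(\eta)$ for all $\eta\in\mathcal P_2(H)$. -/

import Mathlib

open MeasureTheory
open scoped ENNReal

noncomputable section

namespace WassersteinBarycenter

section Defs

variable {H : Type*} [NormedAddCommGroup H] [MeasurableSpace H]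

/-- The second moment `m₂²(μ) = ∫ |x|² dμ(x)` of a measure, with values in `[0, ∞]`. -/
def secondMoment (μ : Measure H) : ℝ≥0∞ :=
  ∫⁻ x, ‖x‖ₑ ^ 2 ∂μ

variable (H) in
/-- `𝒫₂(H)`: the probability measures on `H` with finite second moment. This is a structure of its
own, so that it does not inherit the narrow topology of `ProbabilityMeasure H`. -/
@[ext]
structure P2 where
  /-- The underlying measure on `H`. -/
  toMeasure : Measure H
  isProbabilityMeasure : IsProbabilityMeasure toMeasure
  secondMoment_lt_top : secondMoment toMeasure < ∞

instance (μ : P2 H) : IsProbabilityMeasure μ.toMeasure := μ.isProbabilityMeasure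

/-- The transport plans between `μ` and `ν`: measures on `H × H` with marginals `μ` and `ν`. -/
def transportPlans (μ ν : Measure H) : Set (Measure (H × H)) :=
  {γ | γ.map Prod.fst = μ ∧ γ.map Prod.snd = ν}

/-- The optimal quadratic transport cost between `μ` and `ν`, with values in `[0, ∞]`. -/
def transportCost (μ ν : Measure H) : ℝ≥0∞ :=
  ⨅ γ ∈ transportPlans μ ν, ∫⁻ p, ‖p.1 - p.2‖ₑ ^ 2 ∂γ

/-- The 2-Wasserstein distance on `𝒫₂(H)`: the square root of the optimal quadratic transport cost,
which is finite there. -/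
def W2 (μ ν : P2 H) : ℝ :=
  √(transportCost μ.toMeasure ν.toMeasure).toReal

/-- The topology of the metric `W₂`: a set is open if it contains a `W₂`-ball of positive radius
around each of its points. -/
instance : TopologicalSpace (P2 H) where
  IsOpen U := ∀ μ ∈ U, ∃ ε > 0, {ν : P2 H | W2 μ ν < ε} ⊆ U
  isOpen_univ _ _ := ⟨1, one_pos, Set.subset_univ _⟩
  isOpen_inter U V hU hV μ hμ := by
    obtain ⟨ε, hε, hεU⟩ := hU μ hμ.1
    obtain ⟨δ, hδ, hδV⟩ := hV μ hμ.2
    refine ⟨min ε δ, lt_min hε hδ, fun ν (hν : W2 μ ν < min ε δ) => ⟨hεU ?_, hδV ?_⟩⟩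
    · exact lt_of_lt_of_le hν (min_le_left _ _)
    · exact lt_of_lt_of_le hν (min_le_right _ _)
  isOpen_sUnion S hS μ hμ := by
    obtain ⟨U, hU, hμU⟩ := hμ
    obtain ⟨ε, hε, h⟩ := hS U hU μ hμU
    exact ⟨ε, hε, h.trans (Set.subset_sUnion_of_mem hU)⟩

/-- `𝒫₂(H)` carries the Borel σ-algebra of the metric `W₂`. -/
instance : MeasurableSpace (P2 H) := borel (P2 H)

instance : BorelSpace (P2 H) := ⟨rfl⟩

/-- The integral of a real function against a signed measure `lam` with Jordan decomposition
`lam = lam⁺ - lam⁻`, namely `∫ f dlam = ∫ f dlam⁺ - ∫ f dlam⁻`. -/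
def signedIntegral {X : Type*} [MeasurableSpace X] (lam : SignedMeasure X) (f : X → ℝ) : ℝ :=
  ∫ x, f x ∂lam.toJordanDecomposition.posPart - ∫ x, f x ∂lam.toJordanDecomposition.negPart

/-- The generalized barycenter functional `ℰ(μ) = ∫ W₂²(μ, ν) dlam(ν)`. -/
def energy (lam : SignedMeasure (P2 H)) (μ : P2 H) : ℝ :=
  signedIntegral lam (fun ν => W2 μ ν ^ 2)

end Defs

end WassersteinBarycenter

end

/-! Write `m` for the mass of `λ⁻`; then `λ⁺` has mass `1 + m`, all at `ν₀`. Measures are replaced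
by random variables in the Hilbert space `L²(ν₀ ⊗ du)` over `H × [0, 1]`, where `f₀(x, u) = x` has
law `ν₀`. There `F(f) = (1 + m)‖f - f₀‖² - ∫ W₂²(law f, ν) dλ⁻(ν)` dominates `ℰ(law f)`, and by
`exists_law_eq_norm_sub_lt` its infimum over variables of law `η` is `ℰ(η)`. By
`le_W2_law_midpoint_sq`, the negative part costs at most `m` times the convexity of the squared
norm, so one unit of the `1 + m` survives and `F` is strongly midpoint convex. Its minimizer
projects to a minimizer of `ℰ`, and strong convexity forces uniqueness. -/

namespace WassersteinBarycenter

/-! ### Realizing plans by random variables -/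

section Coupling

open ProbabilityTheory

variable {Ω α β : Type*} [MeasurableSpace Ω] [MeasurableSpace α] [MeasurableSpace β]

/-- A coupling `γ` whose first marginal is the law of `X` is realized by `X` itself and a second
random variable, once the probability space is enlarged by an independent uniform variable. -/
theorem exists_measurable_map_prodMk_eq [StandardBorelSpace β] [Nonempty β]
    (P : Measure Ω) [IsProbabilityMeasure P] {X : Ω → α} (hX : Measurable X)
    (γ : Measure (α × β)) [IsProbabilityMeasure γ] (hγ : γ.map Prod.fst = P.map X) :
    ∃ Y : Ω × unitInterval → β, Measurable Y ∧
      (P.prod volume).map (fun z => (X z.1, Y z)) = γ := by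
  -- The uniform variable samples the conditional law of the second coordinate given `X`.
  obtain ⟨g, hg, hgκ⟩ := Kernel.exists_measurable_map_eq_unitInterval γ.condKernel
  have hY : Measurable fun z : Ω × unitInterval => g (X z.1) z.2 :=
    hg.comp (f := fun z : Ω × unitInterval => (X z.1, z.2)) (by fun_prop)
  refine ⟨fun z => g (X z.1) z.2, hY, ?_⟩
  conv_rhs => rw [← γ.disintegrate γ.condKernel]
  ext s hs
  have hm : Measurable fun z : Ω × unitInterval => (X z.1, g (X z.1) z.2) :=
    (hX.comp measurable_fst).prodMk hY
  rw [Measure.map_apply hm hs, Measure.prod_apply (hm hs), Measure.compProd_apply hs,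
    Measure.fst, hγ, lintegral_map (Kernel.measurable_kernel_prodMk_left hs) hX]
  refine lintegral_congr fun ω => ?_
  rw [← hgκ (X ω), Measure.map_apply (f := g (X ω)) (hg.comp measurable_prodMk_left)
    (measurable_prodMk_left hs)]
  rfl

end Coupling

section General

variable {H : Type*} [NormedAddCommGroup H] {Ω : Type*} [MeasurableSpace Ω]

theorem lintegral_enorm_sq_eq_eLpNorm_sq (P : Measure Ω) (f : Ω → H) :
    ∫⁻ ω, ‖f ω‖ₑ ^ 2 ∂P = eLpNorm f 2 P ^ 2 := by
  have := eLpNorm_nnreal_pow_eq_lintegral (f := f) (μ := P) (p := 2) two_ne_zero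
  norm_num at this
  exact_mod_cast this.symm

theorem lintegral_enorm_sub_sq {P : Measure Ω} (f g : Lp H 2 P) :
    ∫⁻ ω, ‖f ω - g ω‖ₑ ^ 2 ∂P = ENNReal.ofReal (‖f - g‖ ^ 2) := by
  rw [lintegral_enorm_sq_eq_eLpNorm_sq, Lp.norm_def, ← ENNReal.toReal_pow, ENNReal.ofReal_toReal
    (ENNReal.pow_ne_top (Lp.eLpNorm_ne_top _)), eLpNorm_congr_ae (Lp.coeFn_sub f g)]
  rfl

section Lift

variable [NormedSpace ℝ H]

/-- The embedding of `L²(Ω)` into `L²(Ω × [0, 1])`. -/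
noncomputable def lift (P : Measure Ω) :
    Lp H 2 P →ₗᵢ[ℝ] Lp H 2 (P.prod (volume : Measure unitInterval)) :=
  Lp.compMeasurePreservingₗᵢ ℝ Prod.fst measurePreserving_fst

theorem lift_ae_eq {P : Measure Ω} (f : Lp H 2 P) :
    lift P f =ᵐ[P.prod volume] fun z => f z.1 :=
  Lp.coeFn_compMeasurePreserving f measurePreserving_fst

end Lift

variable [MeasurableSpace H]

theorem W2_nonneg (μ ν : P2 H) : 0 ≤ W2 μ ν := Real.sqrt_nonneg _

theorem W2_sq (μ ν : P2 H) :
    W2 μ ν ^ 2 = (transportCost μ.toMeasure ν.toMeasure).toReal :=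
  Real.sq_sqrt ENNReal.toReal_nonneg

end General

/-! ### Laws of `L²` variables and the Wasserstein distance -/

section Law

variable {H : Type*} [NormedAddCommGroup H] [MeasurableSpace H] [BorelSpace H]

theorem memLp_id [SecondCountableTopology H] (μ : P2 H) : MemLp id 2 μ.toMeasure := by
  refine ⟨aestronglyMeasurable_id, ?_⟩
  have h := μ.secondMoment_lt_top
  rw [secondMoment] at h
  have h' := lintegral_enorm_sq_eq_eLpNorm_sq μ.toMeasure (id : H → H)
  simp only [id] at h'
  rw [h'] at h
  simpa using h

variable {Ω : Type*} [MeasurableSpace Ω] {P : Measure Ω} [IsProbabilityMeasure P]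

/-- The law of a square integrable random variable. -/
noncomputable def law (f : Lp H 2 P) : P2 H where
  toMeasure := P.map f
  isProbabilityMeasure :=
    Measure.isProbabilityMeasure_map (Lp.stronglyMeasurable f).measurable.aemeasurable
  secondMoment_lt_top := by
    rw [secondMoment, lintegral_map (by fun_prop) (Lp.stronglyMeasurable f).measurable,
      lintegral_enorm_sq_eq_eLpNorm_sq]
    exact ENNReal.pow_lt_top (Lp.eLpNorm_lt_top f)

theorem law_toLp {f : Ω → H} (hf : MemLp f 2 P) : (law (hf.toLp f)).toMeasure = P.map f :=
  Measure.map_congr hf.coeFn_toLp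

theorem law_lift [NormedSpace ℝ H] (f : Lp H 2 P) : law (lift P f) = law f := by
  ext1
  change (P.prod volume).map (lift P f) = P.map f
  rw [Measure.map_congr (lift_ae_eq f)]
  have h := Measure.map_map (μ := P.prod (volume : Measure unitInterval))
    (Lp.stronglyMeasurable f).measurable measurable_fst
  rw [measurePreserving_fst.map_eq] at h
  exact h.symm

variable [SecondCountableTopology H]

/-- The identity as a random variable on `(H, μ)`. -/
noncomputable def idLp (μ : P2 H) : Lp H 2 μ.toMeasure := (memLp_id μ).toLp id

theorem law_idLp (μ : P2 H) : law (idLp μ) = μ := by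
  ext1
  rw [idLp, law_toLp, Measure.map_id]

theorem transportCost_law_le (f g : Lp H 2 P) :
    transportCost (law f).toMeasure (law g).toMeasure ≤ ENNReal.ofReal (‖f - g‖ ^ 2) := by
  have hf := (Lp.stronglyMeasurable f).measurable
  have hg := (Lp.stronglyMeasurable g).measurable
  refine (iInf₂_le (P.map fun ω => (f ω, g ω)) ⟨?_, ?_⟩).trans ?_
  · rw [lintegral_map (by fun_prop) (hf.prodMk hg), lintegral_enorm_sub_sq]
  · rw [Measure.map_map measurable_fst (hf.prodMk hg)]; rfl
  · rw [Measure.map_map measurable_snd (hf.prodMk hg)]; rfl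

theorem W2_law_le (f g : Lp H 2 P) : W2 (law f) (law g) ≤ ‖f - g‖ :=
  Real.sqrt_le_iff.2 ⟨norm_nonneg _,
    ENNReal.toReal_le_of_le_ofReal (sq_nonneg _) (transportCost_law_le f g)⟩

theorem transportCost_ne_top (μ ν : P2 H) :
    transportCost μ.toMeasure ν.toMeasure ≠ ∞ := by
  have h1 : MemLp (fun z : H × H => z.1) 2 (μ.toMeasure.prod ν.toMeasure) :=
    (memLp_id μ).comp_measurePreserving measurePreserving_fst
  have h2 : MemLp (fun z : H × H => z.2) 2 (μ.toMeasure.prod ν.toMeasure) :=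
    (memLp_id ν).comp_measurePreserving measurePreserving_snd
  have h := transportCost_law_le (h1.toLp _) (h2.toLp _)
  rw [law_toLp, law_toLp, measurePreserving_fst.map_eq, measurePreserving_snd.map_eq] at h
  exact ne_top_of_le_ne_top ENNReal.ofReal_ne_top h

theorem W2_comm (μ ν : P2 H) : W2 μ ν = W2 ν μ := by
  have key : ∀ μ ν : Measure H, transportCost μ ν ≤ transportCost ν μ := by
    intro μ ν
    refine le_iInf₂ fun γ hγ => ?_
    refine (iInf₂_le (γ.map Prod.swap) ⟨?_, ?_⟩).trans ?_
    · rw [lintegral_map (by fun_prop) measurable_swap]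
      simp only [Prod.fst_swap, Prod.snd_swap]
      exact lintegral_mono fun p => by rw [enorm_sub_rev]
    · rw [Measure.map_map measurable_fst measurable_swap]; exact hγ.2
    · rw [Measure.map_map measurable_snd measurable_swap]; exact hγ.1
  rw [W2, W2, le_antisymm (key _ _) (key _ _)]

/-- Every value above `W₂(law f, ν)` bounds the distance of `f` from a variable of law `ν` on the
enlarged probability space. -/
theorem exists_law_eq_norm_sub_lt [CompleteSpace H] [NormedSpace ℝ H] (f : Lp H 2 P) (ν : P2 H)
    {r : ℝ} (hr : W2 (law f) ν < r) :
    ∃ g : Lp H 2 (P.prod (volume : Measure unitInterval)), law g = ν ∧ ‖lift P f - g‖ < r := by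
  have hr0 : 0 < r := (W2_nonneg _ _).trans_lt hr
  have hlt : transportCost (law f).toMeasure ν.toMeasure < ENNReal.ofReal (r ^ 2) := by
    rw [ENNReal.lt_ofReal_iff_toReal_lt (transportCost_ne_top _ _), ← W2_sq]
    exact pow_lt_pow_left₀ hr (W2_nonneg _ _) two_ne_zero
  obtain ⟨γ, hγ, hγr⟩ := by simpa only [transportCost, iInf_lt_iff, exists_prop] using hlt
  have : IsProbabilityMeasure γ := by
    refine ⟨?_⟩
    have h := congrArg (fun m : Measure H => m Set.univ) hγ.2
    simpa [Measure.map_apply measurable_snd] using h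
  have hf := (Lp.stronglyMeasurable f).measurable
  obtain ⟨Y, hY, hYγ⟩ := exists_measurable_map_prodMk_eq P hf γ hγ.1
  have hm : Measurable fun z : Ω × unitInterval => (f z.1, Y z) := (hf.comp measurable_fst).prodMk hY
  have hlaw : (P.prod volume).map Y = ν.toMeasure := by
    rw [← hγ.2, ← hYγ, Measure.map_map measurable_snd hm]; rfl
  have hYLp : MemLp Y 2 (P.prod volume) := (memLp_id ν).comp_measurePreserving ⟨hY, hlaw⟩
  refine ⟨hYLp.toLp Y, by ext1; rw [law_toLp, hlaw], ?_⟩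
  rw [← hYγ, lintegral_map (by fun_prop) hm] at hγr
  have hnorm := lintegral_enorm_sub_sq (lift P f) (hYLp.toLp Y)
  have hcongr : ∫⁻ z, ‖lift P f z - hYLp.toLp Y z‖ₑ ^ 2 ∂(P.prod volume)
      = ∫⁻ z, ‖f z.1 - Y z‖ₑ ^ 2 ∂(P.prod volume) := by
    refine lintegral_congr_ae ?_
    filter_upwards [lift_ae_eq f, hYLp.coeFn_toLp] with z h1 h2
    rw [h1, h2]
  rw [← hcongr, hnorm, ENNReal.ofReal_lt_ofReal_iff (by positivity)] at hγr
  exact lt_of_pow_lt_pow_left₀ 2 hr0.le hγr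

end Law

/-! ### Metric properties of `W₂` -/

section Metric

variable {H : Type*} [NormedAddCommGroup H] [NormedSpace ℝ H] [CompleteSpace H]
  [SecondCountableTopology H] [MeasurableSpace H] [BorelSpace H]

theorem W2_triangle (μ ν ρ : P2 H) : W2 μ ρ ≤ W2 μ ν + W2 ν ρ := by
  refine le_of_forall_pos_le_add fun ε hε => ?_
  -- Two successive enlargements put nearly optimal couplings of both pairs on one probability
  -- space, in place of gluing plans.
  obtain ⟨g, hg, hgr⟩ := exists_law_eq_norm_sub_lt (idLp μ) ν
    (r := W2 μ ν + ε / 2) (by rw [law_idLp]; linarith)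
  obtain ⟨k, hk, hkr⟩ := exists_law_eq_norm_sub_lt g ρ
    (r := W2 ν ρ + ε / 2) (by rw [hg]; linarith)
  have h1 := W2_law_le (lift _ (lift _ (idLp μ))) k
  rw [law_lift, law_lift, law_idLp, hk] at h1
  have h2 := norm_sub_le_norm_sub_add_norm_sub (lift _ (lift _ (idLp μ))) (lift _ g) k
  rw [← map_sub, LinearIsometry.norm_map] at h2
  linarith

theorem continuous_W2 (μ : P2 H) : Continuous (W2 μ) := by
  rw [continuous_def]
  intro V hV ν hν
  obtain ⟨ε, hε, hεV⟩ := Metric.isOpen_iff.1 hV _ hν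
  refine ⟨ε, hε, fun ρ (hρ : W2 ν ρ < ε) => hεV ?_⟩
  have h1 := W2_triangle μ ν ρ
  have h2 := W2_triangle μ ρ ν
  rw [W2_comm ρ ν] at h2
  rw [Metric.mem_ball, Real.dist_eq, abs_sub_lt_iff]
  constructor <;> linarith

/-- Variables of law `ν` converge in `L²`, hence in distribution, to a variable of law `μ`; limits
in distribution are unique. -/
theorem eq_of_W2_eq_zero {μ ν : P2 H} (h : W2 μ ν = 0) : μ = ν := by
  have hex : ∀ n : ℕ, ∃ g : Lp H 2 (μ.toMeasure.prod (volume : Measure unitInterval)),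
      law g = ν ∧ ‖lift _ (idLp μ) - g‖ < 1 / ((n : ℝ) + 1) := fun n =>
    exists_law_eq_norm_sub_lt _ _ (by rw [law_idLp, h]; positivity)
  choose g hg hgr using hex
  have hlim : Filter.Tendsto g Filter.atTop (nhds (lift _ (idLp μ))) := by
    rw [tendsto_iff_norm_sub_tendsto_zero]
    refine squeeze_zero (fun _ => norm_nonneg _) (fun n => ?_)
      tendsto_one_div_add_atTop_nhds_zero_nat
    rw [norm_sub_rev]
    exact (hgr n).le
  have hdist := (tendstoInMeasure_of_tendsto_Lp hlim).tendstoInDistribution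
    fun n => (Lp.stronglyMeasurable (g n)).measurable.aemeasurable
  have hlaw : ∀ n, (μ.toMeasure.prod volume).map (g n) = ν.toMeasure := fun n =>
    congrArg P2.toMeasure (hg n)
  have hlaw0 : (μ.toMeasure.prod volume).map (lift _ (idLp μ)) = μ.toMeasure := by
    have h := (law_lift (idLp μ)).trans (law_idLp μ)
    exact congrArg P2.toMeasure h
  have hν : TendstoInDistribution (fun n => (g n : _ → H)) Filter.atTop id
      (fun _ => μ.toMeasure.prod volume) ν.toMeasure :=
    { forall_aemeasurable := hdist.forall_aemeasurable
      tendsto := by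
        simp only [hlaw, Measure.map_id]
        exact tendsto_const_nhds }
  have heq := tendstoInDistribution_unique _ hdist hν
  ext1
  rw [← hlaw0, heq, Measure.map_id]

end Metric

/-! ### Concavity of the squared distance and strongly convex minimization -/

section Convexity

variable {H : Type*} [NormedAddCommGroup H] [InnerProductSpace ℝ H] [CompleteSpace H]
  [SecondCountableTopology H] [MeasurableSpace H] [BorelSpace H]

theorem norm_midpoint_sub_sq {E : Type*} [NormedAddCommGroup E] [InnerProductSpace ℝ E]
    (x y z : E) :
    ‖midpoint ℝ x y - z‖ ^ 2 = ‖x - z‖ ^ 2 / 2 + ‖y - z‖ ^ 2 / 2 - ‖x - y‖ ^ 2 / 4 := by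
  have h := parallelogram_law_with_norm ℝ (x - z) (y - z)
  have h1 : midpoint ℝ x y - z = (2⁻¹ : ℝ) • ((x - z) + (y - z)) := by
    rw [midpoint_eq_smul_add, invOf_eq_inv]
    module
  have h2 : (x - z) - (y - z) = x - y := by abel
  rw [h1, norm_smul, mul_pow, Real.norm_eq_abs, sq_abs]
  rw [h2] at h
  linarith

/-- `W₂²(·, ν)` is `2`-concave at midpoints of random variables. -/
theorem le_W2_law_midpoint_sq {Ω : Type*} [MeasurableSpace Ω] {P : Measure Ω}
    [IsProbabilityMeasure P] (f g : Lp H 2 P) (ν : P2 H) :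
    W2 (law f) ν ^ 2 / 2 + W2 (law g) ν ^ 2 / 2 - ‖f - g‖ ^ 2 / 4
      ≤ W2 (law (midpoint ℝ f g)) ν ^ 2 := by
  -- No optimal plan is needed: the bound holds with any `r` above the distance, and `r` decreases
  -- to it.
  have hlim : Filter.Tendsto (fun r : ℝ => r ^ 2)
      (nhdsWithin (W2 (law (midpoint ℝ f g)) ν) (Set.Ioi (W2 (law (midpoint ℝ f g)) ν)))
      (nhds (W2 (law (midpoint ℝ f g)) ν ^ 2)) :=
    ((continuous_pow 2).tendsto _).mono_left nhdsWithin_le_nhds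
  refine ge_of_tendsto hlim (Filter.mem_of_superset self_mem_nhdsWithin fun r hr => ?_)
  obtain ⟨k, rfl, hkr⟩ := exists_law_eq_norm_sub_lt _ ν hr
  have hmid : lift P (midpoint ℝ f g) = midpoint ℝ (lift P f) (lift P g) :=
    (lift P).toLinearMap.toAffineMap.map_midpoint f g
  have h := norm_midpoint_sub_sq (lift P f) (lift P g) k
  rw [← hmid, ← map_sub, LinearIsometry.norm_map] at h
  have hf := W2_law_le (lift P f) k
  have hg := W2_law_le (lift P g) k
  rw [law_lift] at hf hg
  have hf' := pow_le_pow_left₀ (W2_nonneg _ _) hf 2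
  have hg' := pow_le_pow_left₀ (W2_nonneg _ _) hg 2
  have hr' := pow_le_pow_left₀ (norm_nonneg _) hkr.le 2
  change _ ≤ r ^ 2
  linarith

/-- A continuous, strongly midpoint convex function that is bounded below on a complete space
attains its infimum. -/
theorem exists_forall_le_of_midpoint_le {E : Type*} [NormedAddCommGroup E] [NormedSpace ℝ E]
    [CompleteSpace E] {F : E → ℝ} (hF : Continuous F) (hbdd : BddBelow (Set.range F))
    (hconv : ∀ x y, F (midpoint ℝ x y) ≤ F x / 2 + F y / 2 - ‖x - y‖ ^ 2 / 4) :
    ∃ x, ∀ y, F x ≤ F y := by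
  set I := ⨅ x, F x
  have hI : ∀ x, I ≤ F x := fun x => ciInf_le hbdd x
  obtain ⟨u, -, hu, humem⟩ := exists_seq_tendsto_sInf (Set.range_nonempty F) hbdd
  change Filter.Tendsto u _ (nhds I) at hu
  choose x hx using humem
  have hdist : ∀ n m, ‖x n - x m‖ ^ 2 ≤ 2 * (u n - I) + 2 * (u m - I) := by
    intro n m
    have h1 := hconv (x n) (x m)
    have h2 := hI (midpoint ℝ (x n) (x m))
    rw [hx, hx] at h1
    linarith
  have hcauchy : CauchySeq x := by
    refine Metric.cauchySeq_iff.2 fun ε hε => ?_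
    have hev : ∀ᶠ n in Filter.atTop, u n < I + ε ^ 2 / 4 :=
      hu.eventually (gt_mem_nhds (by linarith [pow_pos hε 2]))
    obtain ⟨N, hN⟩ := Filter.eventually_atTop.1 hev
    refine ⟨N, fun n hn m hm => ?_⟩
    rw [dist_eq_norm]
    refine lt_of_pow_lt_pow_left₀ 2 hε.le ?_
    linarith [hdist n m, hN n hn, hN m hm]
  obtain ⟨a, ha⟩ := cauchySeq_tendsto_of_complete hcauchy
  refine ⟨a, fun y => ?_⟩
  have hlim : Filter.Tendsto u Filter.atTop (nhds (F a)) := by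
    simpa only [Function.comp_def, hx] using (hF.tendsto a).comp ha
  rw [tendsto_nhds_unique hlim hu]
  exact hI y

end Convexity

/-! ### Integrability of the squared distance -/

section Integrability

variable {H : Type*} [NormedAddCommGroup H] [NormedSpace ℝ H] [CompleteSpace H]
  [SecondCountableTopology H] [MeasurableSpace H] [BorelSpace H]

/-- Triangle inequality through the Dirac mass at `0`, realized as the law of the zero variable. -/
theorem ofReal_W2_sq_le (μ ν : P2 H) :
    ENNReal.ofReal (W2 μ ν ^ 2)
      ≤ 2 * secondMoment μ.toMeasure + 2 * secondMoment ν.toMeasure := by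
  have h0 : ∀ ρ : P2 H, ENNReal.ofReal (‖idLp ρ‖ ^ 2) = secondMoment ρ.toMeasure := by
    intro ρ
    rw [Lp.norm_def, ← ENNReal.toReal_pow, ENNReal.ofReal_toReal
      (ENNReal.pow_ne_top (Lp.eLpNorm_ne_top _)), secondMoment, idLp, eLpNorm_congr_ae
      (memLp_id ρ).coeFn_toLp]
    exact (lintegral_enorm_sq_eq_eLpNorm_sq ρ.toMeasure id).symm
  have hzero : ∀ ρ : P2 H, W2 ρ (law (0 : Lp H 2 μ.toMeasure)) ≤ ‖idLp ρ‖ := by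
    intro ρ
    have hconst : law (0 : Lp H 2 ρ.toMeasure) = law (0 : Lp H 2 μ.toMeasure) := by
      have h : ∀ σ : P2 H, (law (0 : Lp H 2 σ.toMeasure)).toMeasure = Measure.dirac 0 := by
        intro σ
        refine (Measure.map_congr (Lp.coeFn_zero H 2 σ.toMeasure)).trans ?_
        exact (Measure.map_const _ _).trans (by simp; rfl)
      ext1
      rw [h, h]
    have h := W2_law_le (idLp ρ) 0
    rwa [law_idLp, hconst, sub_zero] at h
  have hle : W2 μ ν ^ 2 ≤ 2 * ‖idLp μ‖ ^ 2 + 2 * ‖idLp ν‖ ^ 2 := by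
    have h := W2_triangle μ (law (0 : Lp H 2 μ.toMeasure)) ν
    rw [W2_comm (law 0) ν] at h
    have h' := pow_le_pow_left₀ (W2_nonneg _ _) (h.trans (add_le_add (hzero μ) (hzero ν))) 2
    linarith [sq_nonneg (‖idLp μ‖ - ‖idLp ν‖)]
  refine (ENNReal.ofReal_le_ofReal hle).trans_eq ?_
  rw [ENNReal.ofReal_add (by positivity) (by positivity), ENNReal.ofReal_mul zero_le_two,
    ENNReal.ofReal_mul zero_le_two, h0, h0, ENNReal.ofReal_ofNat]

theorem integrable_W2_sq {Λ : Measure (P2 H)} [IsFiniteMeasure Λ]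
    (hΛ : ∫⁻ ν, secondMoment ν.toMeasure ∂Λ < ∞) (μ : P2 H) :
    Integrable (fun ν => W2 μ ν ^ 2) Λ := by
  refine ⟨((continuous_W2 μ).pow 2).measurable.aestronglyMeasurable, ?_⟩
  rw [hasFiniteIntegral_iff_ofReal (Filter.Eventually.of_forall fun _ => sq_nonneg _)]
  refine (lintegral_mono (ofReal_W2_sq_le μ)).trans_lt ?_
  rw [lintegral_add_left measurable_const, lintegral_const,
    lintegral_const_mul' _ _ ENNReal.ofNat_ne_top]
  exact ENNReal.add_lt_top.2
    ⟨ENNReal.mul_lt_top (ENNReal.mul_lt_top ENNReal.ofNat_lt_top μ.secondMoment_lt_top)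
      (measure_lt_top _ _), ENNReal.mul_lt_top ENNReal.ofNat_lt_top hΛ⟩

end Integrability

theorem integral_eq_of_compl_singleton_null {X : Type*} [MeasurableSpace X] {Λ : Measure X}
    {x₀ : X} (h : Λ {x₀}ᶜ = 0) (φ : X → ℝ) : ∫ x, φ x ∂Λ = Λ.real Set.univ * φ x₀ := by
  have hae : φ =ᵐ[Λ] fun _ => φ x₀ := by
    filter_upwards [compl_mem_ae_iff.2 h] with x hx
    rw [compl_compl] at hx
    rw [Set.mem_singleton_iff.1 hx]
  rw [integral_congr_ae hae, integral_const, smul_eq_mul]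

/-! ### Existence and uniqueness of the minimizer -/

section Minimizer

variable {H : Type*} [NormedAddCommGroup H] [InnerProductSpace ℝ H] [CompleteSpace H]
  [SecondCountableTopology H] [MeasurableSpace H] [BorelSpace H]
  {Λ : Measure (P2 H)} [IsFiniteMeasure Λ]

theorem continuous_integral_W2_law_sq {Ω : Type*} [MeasurableSpace Ω] {P : Measure Ω}
    [IsProbabilityMeasure P] (hint : ∀ μ : P2 H, Integrable (fun ν => W2 μ ν ^ 2) Λ) :
    Continuous fun f : Lp H 2 P => ∫ ν, W2 (law f) ν ^ 2 ∂Λ := by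
  refine continuous_iff_continuousAt.2 fun f => ?_
  -- On the unit ball around `f` the distance grows by at most `1`, and `(1 + a)² ≤ 2 + 2a²`.
  refine continuousAt_of_dominated (bound := fun ν => 2 + 2 * W2 (law f) ν ^ 2)
    (Filter.Eventually.of_forall fun g => (hint _).1) ?_
    ((integrable_const _).add ((hint _).const_mul 2)) (Filter.Eventually.of_forall fun ν => ?_)
  · filter_upwards [Metric.ball_mem_nhds f one_pos] with g hg
    refine Filter.Eventually.of_forall fun ν => ?_
    rw [mem_ball_iff_norm] at hg
    have h := pow_le_pow_left₀ (W2_nonneg _ _)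
      ((W2_triangle _ (law f) ν).trans (add_le_add_left ((W2_law_le g f).trans hg.le) _)) 2
    rw [Real.norm_of_nonneg (sq_nonneg _)]
    linarith [sq_nonneg (W2 (law f) ν - 1)]
  · have hlip : LipschitzWith 1 fun g : Lp H 2 P => W2 (law g) ν := by
      refine LipschitzWith.of_le_add fun g k => ?_
      rw [dist_eq_norm]
      linarith [W2_triangle (law g) (law k) ν, W2_law_le g k]
    exact (hlip.continuous.pow 2).continuousAt

/-- A positive point mass exceeding the negative part by one: the functional
`(1 + Λ(𝒫₂)) W₂²(μ, ν₀) - ∫ W₂²(μ, ν) dΛ(ν)` has a unique minimizer. -/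
theorem existsUnique_forall_le (hint : ∀ μ : P2 H, Integrable (fun ν => W2 μ ν ^ 2) Λ)
    (ν₀ : P2 H) :
    ∃! μ : P2 H, ∀ η : P2 H,
      (1 + Λ.real Set.univ) * W2 μ ν₀ ^ 2 - ∫ ν, W2 μ ν ^ 2 ∂Λ
        ≤ (1 + Λ.real Set.univ) * W2 η ν₀ ^ 2 - ∫ ν, W2 η ν ^ 2 ∂Λ := by
  set m := Λ.real Set.univ with hm
  have hm0 : 0 ≤ m := measureReal_nonneg
  set J : P2 H → ℝ := fun μ => ∫ ν, W2 μ ν ^ 2 ∂Λ with hJ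
  set E : P2 H → ℝ := fun μ => (1 + m) * W2 μ ν₀ ^ 2 - J μ with hE
  set f₀ := lift _ (idLp ν₀) with hf₀
  have hlaw₀ : law f₀ = ν₀ := by rw [hf₀, law_lift, law_idLp]
  set F : Lp H 2 (ν₀.toMeasure.prod (volume : Measure unitInterval)) → ℝ :=
    fun f => (1 + m) * ‖f - f₀‖ ^ 2 - J (law f) with hF
  have hEF : ∀ f, E (law f) ≤ F f := by
    intro f
    have h := pow_le_pow_left₀ (W2_nonneg _ _) (W2_law_le f f₀) 2
    rw [hlaw₀] at h
    have := mul_le_mul_of_nonneg_left h (by positivity : 0 ≤ 1 + m)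
    simp only [hE, hF]
    linarith
  have hrec : ∀ η : P2 H, ∀ ε > 0, ∃ f, law f = η ∧ F f < E η + ε := by
    intro η ε hε
    -- The slack `ε / (1 + m)` becomes `ε` after multiplication by `1 + m`.
    obtain ⟨r, hr, hrε⟩ : ∃ r, W2 ν₀ η < r ∧ r ^ 2 < W2 ν₀ η ^ 2 + ε / (1 + m) := by
      refine ⟨√(W2 ν₀ η ^ 2 + ε / (1 + m) / 2), ?_, ?_⟩
      · exact Real.lt_sqrt_of_sq_lt (by linarith [show 0 < ε / (1 + m) by positivity])
      · rw [Real.sq_sqrt (by positivity)]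
        linarith [show 0 < ε / (1 + m) by positivity]
    obtain ⟨f, hf, hfr⟩ := exists_law_eq_norm_sub_lt (idLp ν₀) η (by rwa [law_idLp])
    refine ⟨f, hf, ?_⟩
    have h1 := (pow_lt_pow_left₀ hfr (norm_nonneg _) two_ne_zero).trans hrε
    rw [norm_sub_rev, W2_comm] at h1
    have h2 := mul_lt_mul_of_pos_left h1 (by positivity : 0 < 1 + m)
    rw [mul_add, mul_div_cancel₀ _ (by positivity : 1 + m ≠ 0)] at h2
    simp only [hE, hF, hf]
    linarith
  have hJmid : ∀ f g : Lp H 2 (ν₀.toMeasure.prod (volume : Measure unitInterval)),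
      J (law f) / 2 + J (law g) / 2 - m * (‖f - g‖ ^ 2 / 4) ≤ J (law (midpoint ℝ f g)) := by
    intro f g
    have h := integral_mono (((hint (law f)).div_const 2).add ((hint (law g)).div_const 2) |>.sub
      (integrable_const (‖f - g‖ ^ 2 / 4))) (hint (law (midpoint ℝ f g)))
      fun ν => le_W2_law_midpoint_sq f g ν
    rwa [integral_sub' (((hint (law f)).div_const 2).add ((hint (law g)).div_const 2))
      (integrable_const _), integral_add' ((hint (law f)).div_const 2)
      ((hint (law g)).div_const 2), integral_div, integral_div, integral_const, smul_eq_mul] at h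
  -- The quadratic gains `1 + m` and the integral loses `m`, which leaves the modulus `1`.
  have hconv : ∀ f g, F (midpoint ℝ f g) ≤ F f / 2 + F g / 2 - ‖f - g‖ ^ 2 / 4 := by
    intro f g
    have h1 := hJmid f g
    have h2 := norm_midpoint_sub_sq f g f₀
    simp only [hF]
    rw [h2]
    linarith
  have hcont : Continuous F :=
    (((continuous_id.sub continuous_const).norm.pow 2).const_mul (1 + m)).sub
      (continuous_integral_W2_law_sq hint)
  have hbdd : BddBelow (Set.range F) := by
    refine ⟨-((m + 2) * J ν₀), ?_⟩
    rintro _ ⟨f, rfl⟩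
    have hpt : ∀ ν, W2 (law f) ν ^ 2
        ≤ (1 + 1 / (m + 1)) * ‖f - f₀‖ ^ 2 + (m + 2) * W2 ν₀ ν ^ 2 := by
      intro ν
      have htri := W2_triangle (law f) (law f₀) ν
      have h := pow_le_pow_left₀ (W2_nonneg _ _)
        (htri.trans (add_le_add_left (W2_law_le f f₀) _)) 2
      rw [hlaw₀] at h
      -- Young's inequality with weight `1 / (m + 1)`: after integration the coefficient `m + m / (m
      -- + 1)` of `‖f - f₀‖²` stays below `1 + m`.
      have hsq : 2 * ‖f - f₀‖ * W2 ν₀ ν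
          ≤ 1 / (m + 1) * ‖f - f₀‖ ^ 2 + (m + 1) * W2 ν₀ ν ^ 2 := by
        have h0 : 0 ≤ 1 / (m + 1) * (‖f - f₀‖ - (m + 1) * W2 ν₀ ν) ^ 2 := by positivity
        have h3 : 1 / (m + 1) * (‖f - f₀‖ - (m + 1) * W2 ν₀ ν) ^ 2
            = 1 / (m + 1) * ‖f - f₀‖ ^ 2 + (m + 1) * W2 ν₀ ν ^ 2
              - 2 * ‖f - f₀‖ * W2 ν₀ ν := by
          field_simp
          ring
        linarith
      linarith
    have h := integral_mono (hint (law f)) ((integrable_const _).add ((hint ν₀).const_mul _)) hpt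
    rw [integral_add' (integrable_const _) ((hint ν₀).const_mul _), integral_const, smul_eq_mul,
      integral_const_mul, ← hm] at h
    have hcoef : m * ((1 + 1 / (m + 1)) * ‖f - f₀‖ ^ 2) ≤ (1 + m) * ‖f - f₀‖ ^ 2 := by
      rw [← mul_assoc]
      refine mul_le_mul_of_nonneg_right ?_ (sq_nonneg _)
      rw [mul_add, mul_one_div, mul_one]
      linarith [(div_le_one (by positivity : 0 < m + 1)).2 (by linarith : m ≤ m + 1)]
    simp only [hF, hJ]
    linarith
  obtain ⟨f, hf⟩ := exists_forall_le_of_midpoint_le hcont hbdd hconv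
  refine ⟨law f, fun η => ?_, fun μ hμ => ?_⟩
  · refine le_of_forall_pos_le_add fun ε hε => ?_
    obtain ⟨g, hg, hgε⟩ := hrec η ε hε
    exact ((hEF f).trans (hf g)).trans hgε.le
  -- A near-optimal `g` of law `μ` satisfies `F g < F f + ε / 2`, so convexity at the midpoint gives
  -- `‖g - f‖² ≤ 2 (F g - F f) < ε`.
  · have hsmall : ∀ ε > 0, W2 μ (law f) ^ 2 ≤ 0 + ε := by
      intro ε hε
      obtain ⟨g, rfl, hgε⟩ := hrec μ (ε / 2) (by positivity)
      have h1 := hconv g f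
      have h2 := hf (midpoint ℝ g f)
      have h3 : E (law g) ≤ E (law f) := hμ (law f)
      have h4 := hEF f
      have h5 := pow_le_pow_left₀ (W2_nonneg _ _) (W2_law_le g f) 2
      linarith
    have h0 := le_of_forall_pos_le_add hsmall
    exact eq_of_W2_eq_zero (pow_eq_zero_iff two_ne_zero |>.1 (le_antisymm h0 (sq_nonneg _)))

end Minimizer

end WassersteinBarycenter

theorem theorem1p1 {H : Type*} [NormedAddCommGroup H] [InnerProductSpace ℝ H] [CompleteSpace H]
    [TopologicalSpace.SeparableSpace H] [MeasurableSpace H] [BorelSpace H]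
    (lam : SignedMeasure (WassersteinBarycenter.P2 H))
    (hmass : lam Set.univ = 1)
    (hmoment : ∫⁻ ν, WassersteinBarycenter.secondMoment ν.toMeasure ∂lam.totalVariation < ∞)
    (ν₀ : WassersteinBarycenter.P2 H)
    (hatom : lam.toJordanDecomposition.posPart {ν₀}ᶜ = 0) :
    (∀ μ : WassersteinBarycenter.P2 H,
      Integrable (fun ν => WassersteinBarycenter.W2 μ ν ^ 2) lam.totalVariation) ∧
    ∃! μ : WassersteinBarycenter.P2 H, ∀ η : WassersteinBarycenter.P2 H,
      WassersteinBarycenter.energy lam μ ≤ WassersteinBarycenter.energy lam η := by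
  have : SecondCountableTopology H := UniformSpace.secondCountable_of_separable H
  have : IsFiniteMeasure lam.totalVariation := by
    unfold SignedMeasure.totalVariation
    infer_instance
  have hint := WassersteinBarycenter.integrable_W2_sq hmoment
  refine ⟨hint, ?_⟩
  have hneg : ∀ μ, Integrable (fun ν => WassersteinBarycenter.W2 μ ν ^ 2)
      lam.toJordanDecomposition.negPart := fun μ =>
    (hint μ).mono_measure (Measure.le_add_left le_rfl)
  have hpos : lam.toJordanDecomposition.posPart.real Set.univ
      = 1 + lam.toJordanDecomposition.negPart.real Set.univ := by
    have h := lam.toSignedMeasure_toJordanDecomposition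
    rw [← h, JordanDecomposition.toSignedMeasure, sub_apply,
      Measure.toSignedMeasure_apply_measurable MeasurableSet.univ,
      Measure.toSignedMeasure_apply_measurable MeasurableSet.univ] at hmass
    linarith
  have henergy : ∀ μ, WassersteinBarycenter.energy lam μ
      = (1 + lam.toJordanDecomposition.negPart.real Set.univ)
          * WassersteinBarycenter.W2 μ ν₀ ^ 2
        - ∫ ν, WassersteinBarycenter.W2 μ ν ^ 2 ∂lam.toJordanDecomposition.negPart := by
    intro μ
    rw [WassersteinBarycenter.energy, WassersteinBarycenter.signedIntegral,
      WassersteinBarycenter.integral_eq_of_compl_singleton_null hatom, hpos]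
  simp only [henergy]
  exact WassersteinBarycenter.existsUnique_forall_le hneg ν₀
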